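/- **Proposition.** A discrete quantum group $\mathbb G=(\ell^\infty(\mathbb G),\Delta,\varphi,\psi)$ consists of a von Neumann algebra $\ell^\infty(\mathbb G)=\bigoplus_{i\in I}M_{n_i}(\mathbb C)$ ($\ell^\infty$-direct sum), a unital normal coassociative $*$-homomorphism $\Delta:\ell^\infty(\mathbb G)\to\ell^\infty(\mathbb G)\,\overline\otimes\,\ell^\infty(\mathbb G)$, and normal semifinite faithful left, respectively right, invariant weights $\varphi,\psi$. An action $\alpha:\mathbb G\curvearrowright N$ on a von Neumann algebra $N$ is an injective $*$-homomorphism $\alpha:N\to\ell^\infty(\mathbb G)\,\overline\otimes\,N$ with $(\Delta\otimes\mathrm{id})\alpha=(\mathrm{id}\otimes\alpha)\alpha$. It is called amenable if there is a (not necessarily normal) conditional expectation $E_\alpha:\ell^\infty(\mathbb G)\,\overline\otimes\,N\to\alpha(N)$ onto $\alpha(N)$ such that $(\mathrm{id}\otimes E_\alpha)(\Delta\otimes\mathrm{id})=(\Delta\otimes\mathrm{id})E_\alpha$. Let $\alpha:\mathbb G\curvearrowright M$ and $\beta:\mathbb G\curvearrowright N$ be actions of a discrete quantum group $\mathbb G$,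 where $M$ is a von Neumann subalgebra of $N$. Suppose that $(N,\mathbb G,\beta)$ is an extension of $(M,\mathbb G,\alpha)$, that is, $\alpha$ is the restriction of $\beta$ to $M$ and there is a (not necessarily normal or equivariant) conditional expectation from $N$ onto $M$. The pair $(N,M)$ is called amenable if there is a conditional expectation $P$ from $N$ onto $M$ that is equivariant: $(\mathrm{id}\otimes P)\beta=\alpha\circ P$. Then: 1. If the action $\alpha$ is amenable, then the pair $(N,M)$ is amenable. 2. If the action $\beta$ is amenable and the pair $(N,M)$ is amenable, then the action $\alpha$ is amenable. -/

import Mathlib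

open scoped ENNReal NNReal

noncomputable section

section Tensor

attribute [local instance] CStarAlgebra.spectralOrder CStarAlgebra.spectralOrderedRing

universe u v
variable {ι : Type v} (n : ι → ℕ) (A : Type u) [NonUnitalCStarAlgebra A]

/-- The `ℓ^∞`-direct sum `⨁_{i ∈ ι} M_{n i}(A)`: families `(X i)_i` of matrices over `A` with
`sup_i ‖X i‖ < ∞`, where `M_{n i}(A)` carries its C⋆-norm, and all operations are blockwise.

`BlockSum n ℂ` is the von Neumann algebra `ℓ^∞(𝔾) = ⨁_i M_{n i}(ℂ)`. For a von Neumann algebra `A`,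
`BlockSum n A` is the von Neumann tensor product `ℓ^∞(𝔾) ⊗̄ A`, the elementary tensor `x ⊗ a` being
the family of matrices with entries `x i p q • a`; in particular `BlockSum n (BlockSum n A)` is
`ℓ^∞(𝔾) ⊗̄ (ℓ^∞(𝔾) ⊗̄ A)`, the outer blocks being the first leg. -/
def BlockSum : Type (max u v) :=
  lp (fun i => CStarMatrix (Fin (n i)) (Fin (n i)) A) ∞

instance : NonUnitalCStarAlgebra (BlockSum n A) :=
  inferInstanceAs (NonUnitalCStarAlgebra (lp (fun i => CStarMatrix (Fin (n i)) (Fin (n i)) A) ∞))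

/-- The order of the C⋆-algebra: `x ≤ y` iff `y - x` is self-adjoint with spectrum in `[0, ∞)`. -/
instance : PartialOrder (BlockSum n A) := CStarAlgebra.spectralOrder _

instance : StarOrderedRing (BlockSum n A) := CStarAlgebra.spectralOrderedRing _

namespace BlockSum
variable {n A}

/-- The `i`-th block. -/
def block (X : BlockSum n A) (i : ι) : CStarMatrix (Fin (n i)) (Fin (n i)) A := X.1 i

/-- The entry `X i p q` of the `i`-th block, i.e. the slice of `X` by the matrix coefficient
functional `x ↦ x i p q` of `ℓ^∞(𝔾)` in the first leg. -/
def entry (X : BlockSum n A) (i : ι) (p q : Fin (n i)) : A := X.block i p q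

theorem ext {X Y : BlockSum n A} (h : ∀ i p q, X.entry i p q = Y.entry i p q) : X = Y :=
  lp.ext (funext fun i => CStarMatrix.ext fun p q => h i p q)

theorem norm_block_le (X : BlockSum n A) (i : ι) : ‖X.block i‖ ≤ ‖X‖ :=
  lp.norm_apply_le_norm ENNReal.top_ne_zero X i

theorem norm_entry_le (X : BlockSum n A) (i : ι) (p q : Fin (n i)) : ‖X.entry i p q‖ ≤ ‖X‖ :=
  (CStarMatrix.norm_entry_le_norm).trans (X.norm_block_le i)

/-- The element given by a bounded family of matrices. -/
def mk (x : ∀ i, CStarMatrix (Fin (n i)) (Fin (n i)) A) (C : ℝ) (h : ∀ i, ‖x i‖ ≤ C) :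
    BlockSum n A :=
  ⟨x, memℓp_infty ⟨C, by rintro _ ⟨i, rfl⟩; exact h i⟩⟩

theorem entry_add (X Y : BlockSum n A) (i p q) :
    (X + Y).entry i p q = X.entry i p q + Y.entry i p q := rfl
theorem entry_zero (i p q) : (0 : BlockSum n A).entry i p q = 0 := rfl
theorem entry_smul (c : ℂ) (X : BlockSum n A) (i p q) :
    (c • X).entry i p q = c • X.entry i p q := rfl
theorem entry_mul (X Y : BlockSum n A) (i p q) :
    (X * Y).entry i p q = ∑ r, X.entry i p r * Y.entry i r q := rfl
theorem entry_star (X : BlockSum n A) (i p q) :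
    (star X).entry i p q = star (X.entry i q p) := rfl


section Comul

open Classical in
/-- The matrix unit `e^k_{ab}` of `ℓ^∞(𝔾)`. -/
def matUnit (k : ι) (a b : Fin (n k)) : BlockSum n ℂ :=
  lp.single ∞ k (CStarMatrix.ofMatrix (Matrix.single a b (1 : ℂ)))

theorem matUnit_entry_self (k : ι) (a b p q : Fin (n k)) :
    (matUnit k a b).entry k p q = if a = p ∧ b = q then 1 else 0 := by
  classical
  have : (matUnit k a b).block k = CStarMatrix.ofMatrix (Matrix.single a b (1 : ℂ)) :=
    lp.single_apply_self _ _ _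
  rw [entry, this]
  exact Matrix.single_apply ..

theorem matUnit_entry_ne {k i : ι} (h : i ≠ k) (a b : Fin (n k)) (p q : Fin (n i)) :
    (matUnit k a b).entry i p q = 0 := by
  classical
  have : (matUnit k a b).block i = 0 := lp.single_apply_ne _ _ _ h
  rw [entry, this]
  rfl

theorem matUnit_mul_self (k : ι) (a b c d : Fin (n k)) :
    (matUnit k a b) * matUnit k c d = if b = c then matUnit k a d else 0 := by
  classical
  refine ext fun i p q => ?_
  rw [entry_mul]
  by_cases h : i = k
  · subst h
    simp only [matUnit_entry_self]
    rw [Finset.sum_eq_single b (by simp +contextual [eq_comm]) (by simp)]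
    split_ifs with hbc <;> simp [matUnit_entry_self, entry_zero] <;> grind
  · split_ifs <;> simp [matUnit_entry_ne h, entry_zero]

theorem matUnit_mul_ne {k l : ι} (h : k ≠ l) (a b : Fin (n k)) (c d : Fin (n l)) :
    (matUnit k a b) * matUnit l c d = 0 := by
  refine ext fun i p q => ?_
  rw [entry_mul, entry_zero]
  refine Finset.sum_eq_zero fun r _ => ?_
  by_cases hi : i = k
  · subst hi
    rw [matUnit_entry_ne h, mul_zero]
  · rw [matUnit_entry_ne hi, zero_mul]

theorem star_matUnit (k : ι) (a b : Fin (n k)) : star (matUnit k a b) = matUnit k b a := by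
  classical
  refine ext fun i p q => ?_
  rw [entry_star]
  by_cases h : i = k
  · subst h
    simp only [matUnit_entry_self]
    split_ifs <;> simp <;> grind
  · simp [matUnit_entry_ne h]

variable (D : BlockSum n ℂ →⋆ₙₐ[ℂ] BlockSum n (BlockSum n ℂ))

/-- The matrix coefficients of `D (e^k_{ab})`. -/
def coeff (k : ι) (a b : Fin (n k)) (i : ι) (p q : Fin (n i)) (j : ι) (r s : Fin (n j)) : ℂ :=
  ((D (matUnit k a b)).entry i p q).entry j r s

theorem coeff_star (k : ι) (a b i p q j r s) :
    coeff D k a b i p q j r s = star (coeff D k b a i q p j s r) := by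
  unfold coeff
  rw [← star_matUnit, map_star, entry_star, entry_star]

theorem entry_finsetSum {κ : Type*} (s : Finset κ) (f : κ → BlockSum n A) (i p q) :
    (∑ k ∈ s, f k).entry i p q = ∑ k ∈ s, (f k).entry i p q := by
  classical
  induction s using Finset.induction_on with
  | empty => simp [entry_zero]
  | insert a s ha ih => rw [Finset.sum_insert ha, Finset.sum_insert ha, entry_add, ih]

theorem entry_mul₂ (X Y : BlockSum n (BlockSum n A)) (i p q j r s) :
    ((X * Y).entry i p q).entry j r s =
      ∑ t, ∑ u, (X.entry i p t).entry j r u * (Y.entry i t q).entry j u s := by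
  rw [entry_mul, entry_finsetSum]
  rfl

theorem coeff_mul_self (k : ι) (a b c d i p q j r s) :
    ∑ t, ∑ u, coeff D k a b i p t j r u * coeff D k c d i t q j u s =
      if b = c then coeff D k a d i p q j r s else 0 := by
  unfold coeff
  rw [← entry_mul₂, ← map_mul, matUnit_mul_self]
  split_ifs
  · rfl
  · rw [map_zero]; rfl

theorem coeff_mul_ne {k l : ι} (h : k ≠ l) (a b c d i p q j r s) :
    ∑ t, ∑ u, coeff D k a b i p t j r u * coeff D l c d i t q j u s = 0 := by
  unfold coeff
  rw [← entry_mul₂, ← map_mul, matUnit_mul_ne h, map_zero]; rfl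

/-- Each pair of blocks `(i, j)` of the target only sees finitely many blocks of the source,
because it is finite dimensional. -/
theorem finite_coeff (i j : ι) :
    {k | ∃ a b p q r s, coeff D k a b i p q j r s ≠ 0}.Finite := by
  set S := {k | ∃ a b p q r s, coeff D k a b i p q j r s ≠ 0}
  let v : S → (Fin (n i) → Fin (n i) → Fin (n j) → Fin (n j) → ℂ) :=
    fun k p q r s => ∑ a, coeff D k a a i p q j r s
  have hmul : ∀ (k : S) (a b : Fin (n k)) (p q r s),
      ∑ t, ∑ u, coeff D k a b i p t j r u * v k t q u s = coeff D k a b i p q j r s := by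
    intro k a b p q r s
    simp only [v, Finset.mul_sum]
    rw [← Finset.sum_congr rfl (fun t _ => Finset.sum_comm), Finset.sum_comm]
    simp [coeff_mul_self]
  have hne : ∀ (k l : S), k ≠ l → ∀ (a b : Fin (n k)) (p q r s),
      ∑ t, ∑ u, coeff D k a b i p t j r u * v l t q u s = 0 := by
    intro k l hkl a b p q r s
    simp only [v, Finset.mul_sum]
    rw [← Finset.sum_congr rfl (fun t _ => Finset.sum_comm), Finset.sum_comm]
    exact Finset.sum_eq_zero fun c _ => coeff_mul_ne D (fun h => hkl (Subtype.ext h)) ..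
  have hli : LinearIndependent ℂ v := by
    rw [linearIndependent_iff']
    intro F g hg k hk
    obtain ⟨a, b, p, q, r, s, hc⟩ := k.2
    have h0 : ∑ t, ∑ u, coeff D k a b i p t j r u * (∑ l ∈ F, g l • v l) t q u s = 0 := by
      rw [hg]; simp
    have h1 : ∑ t, ∑ u, coeff D k a b i p t j r u * (∑ l ∈ F, g l • v l) t q u s =
        ∑ l ∈ F, g l * ∑ t, ∑ u, coeff D k a b i p t j r u * v l t q u s := by
      simp only [Finset.sum_apply, Pi.smul_apply, smul_eq_mul, Finset.mul_sum]
      rw [← Finset.sum_congr rfl (fun t _ => Finset.sum_comm), Finset.sum_comm]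
      refine Finset.sum_congr rfl fun l _ => Finset.sum_congr rfl fun t _ =>
        Finset.sum_congr rfl fun u _ => by ring
    rw [h1, Finset.sum_eq_single k (fun l _ hl => by rw [hne k l hl.symm, mul_zero])
      (fun h => absurd hk h), hmul] at h0
    exact (mul_eq_zero.mp h0).resolve_right hc
  have := hli.finite_of_isNoetherian
  exact Set.toFinite S

/-- The entries of `(D ⊗ id)(X)`; the sum over `k` is finite by `finite_coeff`. -/
def comulBlock (X : BlockSum n A) (i j : ι) (p q : Fin (n i)) (r s : Fin (n j)) : A :=
  ∑ᶠ k, ∑ a, ∑ b, coeff D k a b i p q j r s • X.entry k a b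

theorem comulBlock_eq (X : BlockSum n A) (i j : ι) (p q : Fin (n i)) (r s : Fin (n j)) :
    comulBlock D X i j p q r s = ∑ k ∈ (finite_coeff D i j).toFinset,
      ∑ a, ∑ b, coeff D k a b i p q j r s • X.entry k a b := by
  refine finsum_eq_sum_of_support_subset _ fun k hk => ?_
  by_contra h
  simp only [Set.Finite.coe_toFinset, Set.mem_ofPred_eq, not_exists, ne_eq, not_not] at h
  exact hk (by simp [h])

theorem comulBlock_mul (X Y : BlockSum n A) (i j : ι) (p q : Fin (n i)) (r s : Fin (n j)) :
    comulBlock D (X * Y) i j p q r s =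
      ∑ t, ∑ u, comulBlock D X i j p t r u * comulBlock D Y i j t q u s := by
  simp only [comulBlock_eq]
  set F := (finite_coeff D i j).toFinset
  have key : ∀ t u, (∑ k ∈ F, ∑ a, ∑ b, coeff D k a b i p t j r u • X.entry k a b) *
      (∑ k ∈ F, ∑ a, ∑ b, coeff D k a b i t q j u s • Y.entry k a b) =
      ∑ k ∈ F, ∑ a, ∑ b, ∑ l ∈ F, ∑ c, ∑ d,
        (coeff D k a b i p t j r u * coeff D l c d i t q j u s) •
          (X.entry k a b * Y.entry l c d) := by
    intro t u
    simp only [Finset.sum_mul]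
    refine Finset.sum_congr rfl fun k _ => Finset.sum_congr rfl fun a _ =>
      Finset.sum_congr rfl fun b _ => ?_
    simp only [Finset.mul_sum, smul_mul_smul_comm]
  have hprod : ∀ g : Fin (n i) → Fin (n j) → A, ∑ t, ∑ u, g t u =
      ∑ w ∈ (Finset.univ : Finset (Fin (n i))) ×ˢ (Finset.univ : Finset (Fin (n j))),
        g w.1 w.2 := fun g => (Finset.sum_product' _ _ _).symm
  rw [hprod]
  simp only [key]
  symm
  rw [Finset.sum_comm]
  refine Finset.sum_congr rfl fun k hk => ?_
  rw [Finset.sum_comm]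
  refine Finset.sum_congr rfl fun a _ => ?_
  rw [Finset.sum_comm]
  have h2 : ∀ b, (∑ w ∈ (Finset.univ : Finset (Fin (n i))) ×ˢ (Finset.univ : Finset (Fin (n j))),
      ∑ l ∈ F, ∑ c, ∑ d, (coeff D k a b i p w.1 j r w.2 * coeff D l c d i w.1 q j w.2 s) •
          (X.entry k a b * Y.entry l c d)) =
      ∑ d, coeff D k a d i p q j r s • (X.entry k a b * Y.entry k b d) := by
    intro b
    have h3 : ∀ l (c d : Fin (n l)),
        (∑ w ∈ (Finset.univ : Finset (Fin (n i))) ×ˢ (Finset.univ : Finset (Fin (n j))),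
          (coeff D k a b i p w.1 j r w.2 * coeff D l c d i w.1 q j w.2 s) •
          (X.entry k a b * Y.entry l c d)) =
        (∑ t, ∑ u, coeff D k a b i p t j r u * coeff D l c d i t q j u s) •
          (X.entry k a b * Y.entry l c d) := by
      intro l c d
      rw [← Finset.sum_smul, Finset.sum_product]
    rw [Finset.sum_comm, Finset.sum_eq_single k]
    · rw [Finset.sum_comm, Finset.sum_eq_single b]
      · rw [Finset.sum_comm]
        refine Finset.sum_congr rfl fun d _ => ?_
        rw [h3, coeff_mul_self, if_pos rfl]
      · intro c _ hc
        rw [Finset.sum_comm]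
        refine Finset.sum_eq_zero fun d _ => ?_
        rw [h3, coeff_mul_self, if_neg (Ne.symm hc), zero_smul]
      · simp
    · intro l _ hl
      rw [Finset.sum_comm]
      refine Finset.sum_eq_zero fun c _ => ?_
      rw [Finset.sum_comm]
      refine Finset.sum_eq_zero fun d _ => ?_
      rw [h3, coeff_mul_ne D (Ne.symm hl), zero_smul]
    · exact fun h => absurd hk h
  simp only [h2, entry_mul, Finset.smul_sum]
  rw [Finset.sum_comm]

/-- The block `(i, j)` of `D ⊗ id`. -/
def comulBlockHom (i j : ι) : BlockSum n A →⋆ₙₐ[ℂ]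
    CStarMatrix (Fin (n i)) (Fin (n i)) (CStarMatrix (Fin (n j)) (Fin (n j)) A) where
  toFun X := CStarMatrix.ofMatrix fun p q => CStarMatrix.ofMatrix fun r s =>
    comulBlock D X i j p q r s
  map_smul' c X := by
    refine CStarMatrix.ext fun p q => CStarMatrix.ext fun r s => ?_
    change comulBlock D (c • X) i j p q r s = c • comulBlock D X i j p q r s
    simp only [comulBlock_eq, entry_smul, Finset.smul_sum, smul_comm c]
  map_zero' := by
    refine CStarMatrix.ext fun p q => CStarMatrix.ext fun r s => ?_
    change comulBlock D (0 : BlockSum n A) i j p q r s = 0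
    simp only [comulBlock_eq, entry_zero, smul_zero, Finset.sum_const_zero]
  map_add' X Y := by
    refine CStarMatrix.ext fun p q => CStarMatrix.ext fun r s => ?_
    change comulBlock D (X + Y) i j p q r s =
      comulBlock D X i j p q r s + comulBlock D Y i j p q r s
    simp only [comulBlock_eq, entry_add, smul_add, Finset.sum_add_distrib]
  map_mul' X Y := by
    refine CStarMatrix.ext fun p q => CStarMatrix.ext fun r s => ?_
    have hsum : ∀ f : Fin (n i) → CStarMatrix (Fin (n j)) (Fin (n j)) A,
        (∑ t, f t) r s = ∑ t, f t r s := fun f =>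
      (congrFun (Finset.sum_apply (M := fun _ => Fin (n j) → A) r Finset.univ f) s).trans
        (Finset.sum_apply s Finset.univ fun t => f t r)
    rw [CStarMatrix.mul_apply, hsum]
    exact comulBlock_mul D X Y i j p q r s
  map_star' X := by
    refine CStarMatrix.ext fun p q => CStarMatrix.ext fun r s => ?_
    change comulBlock D (star X) i j p q r s = star (comulBlock D X i j q p s r)
    simp only [comulBlock_eq, star_sum, star_smul, entry_star, ← coeff_star]
    refine Finset.sum_congr rfl fun k _ => ?_
    rw [Finset.sum_comm]

theorem comulBlockHom_apply (X : BlockSum n A) (i j : ι) (p q r s) :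
    comulBlockHom D i j X p q r s = comulBlock D X i j p q r s := rfl

/-- The `i`-th outer block of `D ⊗ id`. -/
def comulRowHom (i : ι) : BlockSum n A →⋆ₙₐ[ℂ]
    CStarMatrix (Fin (n i)) (Fin (n i)) (BlockSum n A) where
  toFun X := CStarMatrix.ofMatrix fun p q => mk (fun j => comulBlockHom D i j X p q) ‖X‖ fun j =>
    CStarMatrix.norm_entry_le_norm.trans (NonUnitalStarAlgHom.norm_apply_le (comulBlockHom D i j) X)
  map_smul' c X := CStarMatrix.ext fun p q => ext fun j r s => by
    change comulBlockHom D i j (c • X) p q r s = c • comulBlockHom D i j X p q r s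
    rw [map_smul]; rfl
  map_zero' := CStarMatrix.ext fun p q => ext fun j r s => by
    change comulBlockHom D i j (0 : BlockSum n A) p q r s = 0
    rw [map_zero]; rfl
  map_add' X Y := CStarMatrix.ext fun p q => ext fun j r s => by
    change comulBlockHom D i j (X + Y) p q r s = 
      comulBlockHom D i j X p q r s + comulBlockHom D i j Y p q r s
    rw [map_add]; rfl
  map_mul' X Y := CStarMatrix.ext fun p q => ext fun j r s => by
    rw [CStarMatrix.mul_apply, entry_finsetSum]
    exact comulBlock_mul D X Y i j p q r s
  map_star' X := CStarMatrix.ext fun p q => ext fun j r s => by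
    change comulBlockHom D i j (star X) p q r s = star (comulBlockHom D i j X q p s r)
    rw [map_star]; rfl

variable (A) in
/-- The normal extension `D ⊗ id : ℓ^∞(𝔾) ⊗̄ A → ℓ^∞(𝔾) ⊗̄ ℓ^∞(𝔾) ⊗̄ A` of a normal
`⋆`-homomorphism `D : ℓ^∞(𝔾) → ℓ^∞(𝔾) ⊗̄ ℓ^∞(𝔾)`. Writing `X = ∑ e^k_{ab} ⊗ X k a b`, it is
`∑ D (e^k_{ab}) ⊗ X k a b`, and in each entry of the result only finitely many `k` contribute; see
`comulTensorId_entry`. -/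
def comulTensorId : BlockSum n A →⋆ₙₐ[ℂ] BlockSum n (BlockSum n A) where
  toFun X := mk (fun i => comulRowHom D i X) ‖X‖ fun i =>
    NonUnitalStarAlgHom.norm_apply_le (comulRowHom D i) X
  map_smul' c X := ext fun i p q => by
    change comulRowHom D i (c • X) p q = c • comulRowHom D i X p q
    rw [map_smul]; rfl
  map_zero' := ext fun i p q => by
    change comulRowHom D i (0 : BlockSum n A) p q = 0
    rw [map_zero]; rfl
  map_add' X Y := ext fun i p q => by
    change comulRowHom D i (X + Y) p q = comulRowHom D i X p q + comulRowHom D i Y p q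
    rw [map_add]; rfl
  map_mul' X Y := ext fun i p q => by
    change comulRowHom D i (X * Y) p q = _
    rw [map_mul]; rfl
  map_star' X := ext fun i p q => by
    change comulRowHom D i (star X) p q = star (comulRowHom D i X q p)
    rw [map_star]; rfl

theorem comulTensorId_entry (X : BlockSum n A) (i : ι) (p q : Fin (n i)) (j : ι)
    (r s : Fin (n j)) : ((comulTensorId A D X).entry i p q).entry j r s =
      ∑ᶠ k, ∑ a, ∑ b, ((D (matUnit k a b)).entry i p q).entry j r s • X.entry k a b := rfl
end Comul

theorem norm_one_block_le (i : ι) : ‖(1 : CStarMatrix (Fin (n i)) (Fin (n i)) ℂ)‖ ≤ 1 := by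
  rcases subsingleton_or_nontrivial (CStarMatrix (Fin (n i)) (Fin (n i)) ℂ) with h | h
  · rw [Subsingleton.elim (1 : CStarMatrix (Fin (n i)) (Fin (n i)) ℂ) 0, norm_zero]
    exact zero_le_one
  · exact (CStarRing.norm_one).le

/-- The unit of `ℓ^∞(𝔾)`. -/
instance : One (BlockSum n ℂ) := ⟨mk (fun _ => 1) 1 norm_one_block_le⟩

/-- The slice `(ω ⊗ id)(Y)` of `Y ∈ ℓ^∞(𝔾) ⊗̄ A` by a normal functional `ω` on `ℓ^∞(𝔾)`; the sum
over the blocks converges in norm. -/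
def sliceLeft (ω : BlockSum n ℂ →L[ℂ] ℂ) (Y : BlockSum n A) : A :=
  ∑' i, ∑ p, ∑ q, ω (matUnit i p q) • Y.entry i p q

/-- `y = (id ⊗ ω)(Y)` for `Y ∈ ℓ^∞(𝔾) ⊗̄ A` and a bounded functional `ω` on `A`. -/
def IsSliceRight (ω : A →L[ℂ] ℂ) (Y : BlockSum n A) (y : BlockSum n ℂ) : Prop :=
  ∀ i p q, y.entry i p q = ω (Y.entry i p q)

end BlockSum
end Tensor

section QuantumGroup

universe u v

/-- Normality: preservation of the suprema of bounded increasing nets. -/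
def IsNormalMap {A B : Type*} [Preorder A] [Preorder B] (f : A → B) : Prop :=
  ∀ (S : Set A) (x : A), S.Nonempty → DirectedOn (· ≤ ·) S → IsLUB S x → IsLUB (f '' S) (f x)

/-- `ω` is a normal positive functional, i.e. a positive element of the predual `ℓ^1(𝔾)`. -/
structure IsNormalPositive {ι : Type v} {n : ι → ℕ} (ω : BlockSum n ℂ →L[ℂ] ℂ) : Prop where
  nonneg : ∀ x, 0 ≤ x → 0 ≤ (ω x).re ∧ (ω x).im = 0
  normal : IsNormalMap fun x => (ω x).re

/-- `φ` is a normal semifinite faithful weight on `ℓ^∞(𝔾)`. Only the values of `φ` on the positive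
cone matter. -/
structure IsNSFWeight {ι : Type v} {n : ι → ℕ} (φ : BlockSum n ℂ → ℝ≥0∞) : Prop where
  map_add : ∀ x y, 0 ≤ x → 0 ≤ y → φ (x + y) = φ x + φ y
  map_smul : ∀ (c : ℝ≥0) x, 0 ≤ x → φ (((c : ℝ) : ℂ) • x) = c * φ x
  normal : ∀ (S : Set (BlockSum n ℂ)) (x : BlockSum n ℂ), S.Nonempty → (∀ s ∈ S, 0 ≤ s) →
    DirectedOn (· ≤ ·) S → IsLUB S x → φ x = ⨆ s ∈ S, φ s
  faithful : ∀ x, 0 ≤ x → φ x = 0 → x = 0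
  /-- An increasing net of positive elements of finite weight has supremum `1`. -/
  semifinite : ∃ S : Set (BlockSum n ℂ), S.Nonempty ∧ (∀ s ∈ S, 0 ≤ s ∧ φ s < ∞) ∧
    DirectedOn (· ≤ ·) S ∧ IsLUB S 1

/-- A discrete quantum group `𝔾 = (ℓ^∞(𝔾), Δ, φ, ψ)` with `ℓ^∞(𝔾) = ⨁_i M_{dim i}(ℂ)`. -/
structure DiscreteQuantumGroup where
  index : Type v
  index_nonempty : Nonempty index
  dim : index → ℕ
  dim_pos : ∀ i, 0 < dim i
  /-- The comultiplication `Δ`, a unital normal coassociative `⋆`-homomorphism. -/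
  comul : BlockSum dim ℂ →⋆ₙₐ[ℂ] BlockSum dim (BlockSum dim ℂ)
  comul_one : ∀ i p q, (comul 1).entry i p q = if p = q then 1 else 0
  comul_normal : IsNormalMap comul
  /-- `(id ⊗ Δ)Δ = (Δ ⊗ id)Δ`. -/
  coassoc : ∀ x i p q, comul ((comul x).entry i p q) =
    (BlockSum.comulTensorId (BlockSum dim ℂ) comul (comul x)).entry i p q
  leftHaar : BlockSum dim ℂ → ℝ≥0∞
  leftHaar_weight : IsNSFWeight leftHaar
  /-- `φ((ω ⊗ id)Δ(x)) = ω(1)φ(x)`. -/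
  leftHaar_invariant : ∀ x, 0 ≤ x → leftHaar x < ∞ → ∀ ω, IsNormalPositive ω →
    leftHaar (BlockSum.sliceLeft ω (comul x)) = ENNReal.ofReal (ω 1).re * leftHaar x
  rightHaar : BlockSum dim ℂ → ℝ≥0∞
  rightHaar_weight : IsNSFWeight rightHaar
  /-- `ψ((id ⊗ ω)Δ(x)) = ω(1)ψ(x)`. -/
  rightHaar_invariant : ∀ x, 0 ≤ x → rightHaar x < ∞ → ∀ ω, IsNormalPositive ω →
    ∀ y, BlockSum.IsSliceRight ω (comul x) y →
      rightHaar y = ENNReal.ofReal (ω 1).re * rightHaar x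

/-- `E : A → B` is a conditional expectation of `A` onto its `⋆`-subalgebra `B`, embedded by `incl`:
a positive `B`-bimodule projection. (For C⋆-algebras these are, by Tomiyama's theorem, exactly the
norm one projections onto `B`, and they are completely positive.) -/
structure IsConditionalExpectation {A B : Type*} [NonUnitalCStarAlgebra A] [NonUnitalRing B]
    [StarRing B] [Module ℂ B] (incl : B →⋆ₙₐ[ℂ] A) (E : A →ₗ[ℂ] B) : Prop where
  positive : ∀ x, ∃ y, E (star x * x) = star y * y
  map_incl : ∀ b, E (incl b) = b
  bimodule : ∀ b x c, E (incl b * x * incl c) = b * E x * c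

namespace DiscreteQuantumGroup

/-- The von Neumann algebra `ℓ^∞(𝔾) ⊗̄ A`. -/
abbrev Tensor (G : DiscreteQuantumGroup.{v}) (A : Type u) [NonUnitalCStarAlgebra A] :
    Type (max u v) :=
  BlockSum G.dim A

/-- `Δ ⊗ id : ℓ^∞(𝔾) ⊗̄ A → ℓ^∞(𝔾) ⊗̄ (ℓ^∞(𝔾) ⊗̄ A)`. -/
def comulId (G : DiscreteQuantumGroup.{v}) {A : Type u} [NonUnitalCStarAlgebra A] :
    G.Tensor A →⋆ₙₐ[ℂ] G.Tensor (G.Tensor A) :=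
  BlockSum.comulTensorId A G.comul

/-- A left action of `𝔾` on `A`: an injective `⋆`-homomorphism `α : A → ℓ^∞(𝔾) ⊗̄ A` such that
`(Δ ⊗ id)α = (id ⊗ α)α`. Neither unitality nor normality of `α` is demanded, so that in particular
all unital normal actions are covered. -/
structure Action (G : DiscreteQuantumGroup.{v}) (A : Type u) [NonUnitalCStarAlgebra A] where
  hom : A →⋆ₙₐ[ℂ] G.Tensor A
  injective : Function.Injective hom
  coaction : ∀ x i p q, (G.comulId (hom x)).entry i p q = hom ((hom x).entry i p q)

/-- `α` is amenable: there is a conditional expectation `E : ℓ^∞(𝔾) ⊗̄ A → α(A)` such that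
`(id ⊗ E)(Δ ⊗ id) = (Δ ⊗ id)E`. -/
def Action.IsAmenable {G : DiscreteQuantumGroup.{v}} {A : Type u} [NonUnitalCStarAlgebra A]
    (α : G.Action A) : Prop :=
  ∃ E : G.Tensor A →ₗ[ℂ] NonUnitalStarAlgHom.range α.hom,
    IsConditionalExpectation
      (NonUnitalStarSubalgebraClass.subtype (NonUnitalStarAlgHom.range α.hom)) E ∧
    ∀ X i p q, (E ((G.comulId X).entry i p q) : G.Tensor A) =
      (G.comulId (E X : G.Tensor A)).entry i p q

/-- The map `Φ : (A, α) → (B, β)` is equivariant: `(id ⊗ Φ)α = β ∘ Φ`. -/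
def IsEquivariant {G : DiscreteQuantumGroup.{v}} {A B : Type u} [NonUnitalCStarAlgebra A]
    [NonUnitalCStarAlgebra B] (α : G.Action A) (β : G.Action B) (Φ : A →ₗ[ℂ] B) : Prop :=
  ∀ x i p q, Φ ((α.hom x).entry i p q) = (β.hom (Φ x)).entry i p q

end DiscreteQuantumGroup

end QuantumGroup

namespace VonNeumannAlgebra

universe u v

variable {H : Type u} [NormedAddCommGroup H] [InnerProductSpace ℂ H] [CompleteSpace H]

instance : SMulMemClass (VonNeumannAlgebra H) ℂ (H →L[ℂ] H) where
  smul_mem {s} c _ hx := s.toStarSubalgebra.smul_mem hx c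

/-- A von Neumann algebra is norm closed, so that it is a C⋆-algebra. -/
instance (N : VonNeumannAlgebra H) : IsClosed (N : Set (H →L[ℂ] H)) := by
  rw [← N.centralizer_centralizer]
  exact Set.isClosed_centralizer _

/-- The inclusion of a von Neumann subalgebra `M` of `N`. -/
def inclusion {M N : VonNeumannAlgebra H} (h : M ≤ N) : M →⋆ₙₐ[ℂ] N where
  toFun x := ⟨x, h x.2⟩
  map_smul' _ _ := rfl
  map_zero' := rfl
  map_add' _ _ := rfl
  map_mul' _ _ := rfl
  map_star' _ := rfl

/-- `(N, 𝔾, β)` is an extension of `(M, 𝔾, α)`: `M` is a von Neumann subalgebra of `N`, `α` is the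
restriction of `β` to `M`, and there is a conditional expectation from `N` onto `M`. -/
structure IsExtension {G : DiscreteQuantumGroup.{v}} {M N : VonNeumannAlgebra H}
    (β : G.Action N) (α : G.Action M) : Prop where
  le : M ≤ N
  restrict : ∀ x i p q, (β.hom (inclusion le x)).entry i p q =
    inclusion le ((α.hom x).entry i p q)
  exists_expectation : ∃ Q : N →ₗ[ℂ] M, IsConditionalExpectation (inclusion le) Q

/-- The pair `(N, M)` is amenable: there is an equivariant conditional expectation from `(N, β)`
onto `(M, α)`. -/
def IsAmenablePair {G : DiscreteQuantumGroup.{v}} {M N : VonNeumannAlgebra H}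
    {β : G.Action N} {α : G.Action M} (h : IsExtension β α) : Prop :=
  ∃ P : N →ₗ[ℂ] M, IsConditionalExpectation (inclusion h.le) P ∧
    DiscreteQuantumGroup.IsEquivariant β α P

end VonNeumannAlgebra
end

/-!
The point of the proof is that amenability of an action only depends on `α` as an embedding: since
`α` is injective, it is amenable iff there is a conditional expectation `F : ℓ^∞(𝔾) ⊗̄ A → A`
relative to the embedding `α` which satisfies `(id ⊗ F)(Δ ⊗ id) = α ∘ F`
(`DiscreteQuantumGroup.Action.isAmenable_iff`). Let `j : M → N` be the inclusion, so that
`β ∘ j = (id ⊗ j) ∘ α`. Two formal operations on conditional expectations are used: composition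
along `C → B → A` (`IsConditionalExpectation.comp`), and restriction of an expectation `A → B` to an
intermediate algebra `B → C → A` (`IsConditionalExpectation.restrict`).

* If `F : ℓ^∞(𝔾) ⊗̄ M → M` witnesses the amenability of `α` and `Q : N → M` is any expectation, then
  `F ∘ (id ⊗ Q)` is an expectation relative to `(id ⊗ j) ∘ α = β ∘ j`, so its restriction
  `P = F ∘ (id ⊗ Q) ∘ β` is an expectation relative to `j`.
* If `F : ℓ^∞(𝔾) ⊗̄ N → N` witnesses the amenability of `β` and `P : N → M` is equivariant, then
  `P ∘ F` is an expectation relative to `β ∘ j = (id ⊗ j) ∘ α`, so its restriction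
  `P ∘ F ∘ (id ⊗ j)` is an expectation relative to `α`.

Equivariance holds because `Δ ⊗ id` commutes with entrywise linear maps, each entry of
`(Δ ⊗ id)(X)` being a finite linear combination of entries of `X`
(`BlockSum.comulTensorId_entry_map`).

The analytic content is the existence of `id ⊗ Q` as an expectation when `Q` is not normal
(`IsConditionalExpectation.exists_tensor`). For vectors `v, w` in the standard Hilbert C⋆-module
over `M`, the bimodule property gives `⟪w, Q(X) v⟫ = Q ⟪j w, X (j v)⟫`, where `Q` acts on the entries
of the matrix `X`. As `Q` is positive, it is bounded, so this bounds all matrix amplifications of `Q`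
by the same constant. It also shows that `⟪v, Q(X) v⟫ ≥ 0` for `X ≥ 0`, whence `Q(X) ≥ 0`
(`CStarMatrix.exists_eq_star_mul_self_of_forall_inner`).
-/

noncomputable section
/-! ### Matrix amplifications of conditional expectations -/

section MatrixAmplification

attribute [local instance] CStarAlgebra.spectralOrder CStarAlgebra.spectralOrderedRing

open scoped InnerProductSpace WithCStarModule CStarMatrix Matrix

variable {m : Type*} [Fintype m] {A B : Type*} [NonUnitalCStarAlgebra A] [NonUnitalCStarAlgebra B]

/-- A self-adjoint `T` is compressed by `s = T⁻` to `-s³`, which is minus a square `star c * c`; if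
that square vanishes, then so does `T⁻`, and `T` is positive. -/
theorem NonUnitalCStarAlgebra.exists_compression_eq_neg {T : A} (hT : IsSelfAdjoint T) :
    ∃ s c : A, star s = s ∧ s * T * s = -(star c * c) ∧ (c = 0 → ∃ y, T = star y * y) := by
  have hs : 0 ≤ T⁻ := CFC.negPart_nonneg T
  have hsa : star T⁻ = T⁻ := hs.isSelfAdjoint
  obtain ⟨r, hr⟩ := CStarAlgebra.nonneg_iff_eq_star_mul_self.mp hs
  have hcube : T⁻ * T⁻ * T⁻ = star (r * T⁻) * (r * T⁻) := by
    rw [star_mul, hsa]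
    conv_lhs => enter [1, 2]; rw [hr]
    simp only [mul_assoc]
  refine ⟨T⁻, r * T⁻, hsa, ?_, fun hc => ?_⟩
  · rw [← hcube]
    conv_lhs => enter [1, 2]; rw [← CFC.posPart_sub_negPart T hT]
    rw [mul_sub, CFC.negPart_mul_posPart, zero_sub, neg_mul]
  · have hfour : star (T⁻ * T⁻) * (T⁻ * T⁻) = 0 := by
      rw [star_mul, hsa, ← mul_assoc, hcube, hc, mul_zero, zero_mul]
    have hsq : star T⁻ * T⁻ = 0 := by
      rw [hsa]
      exact (CStarRing.star_mul_self_eq_zero_iff _).mp hfour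
    have hpos : 0 ≤ T := by
      rw [← CFC.posPart_sub_negPart T hT, (CStarRing.star_mul_self_eq_zero_iff _).mp hsq, sub_zero]
      exact CFC.posPart_nonneg T
    exact CStarAlgebra.nonneg_iff_eq_star_mul_self.mp hpos

namespace CStarMatrix

/-- Matrices act on row vectors from the right, so the order of the factors is reversed. -/
theorem toCLM_mul_apply (S T : CStarMatrix m m A) (v : C⋆ᵐᵒᵈ(A, m → A)) :
    toCLM (S * T) v = toCLM T (toCLM S v) := by
  change (MulOpposite.unop (toCLMNonUnitalAlgHom (A := A) (S * T))) v = _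
  rw [map_mul]
  rfl

/-- A self-adjoint matrix `T` over a C⋆-algebra is positive if `⟪v, T v⟫ ≥ 0` for all `v` in the
standard Hilbert C⋆-module: apply this to `s v`, where `s` is the negative part of `T`. -/
theorem exists_eq_star_mul_self_of_forall_inner {T : CStarMatrix m m A} (hT : IsSelfAdjoint T)
    (h : ∀ v : C⋆ᵐᵒᵈ(A, m → A), 0 ≤ ⟪v, toCLM T v⟫_A) : ∃ Y, T = star Y * Y := by
  obtain ⟨s, c, hs, hsT, hc⟩ := NonUnitalCStarAlgebra.exists_compression_eq_neg hT
  refine hc (star_eq_zero.mp (toCLM_injective ?_))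
  rw [map_zero]
  ext1 v
  have hinner : ⟪v, toCLM (star c * c) v⟫_A = ⟪toCLM (star c) v, toCLM (star c) v⟫_A := by
    rw [toCLM_mul_apply, ← inner_toCLM_conjTranspose_left]
    rfl
  have hnonneg : 0 ≤ ⟪v, toCLM (s * T * s) v⟫_A := by
    have hs' : sᴴ = s := hs
    rw [toCLM_mul_apply, toCLM_mul_apply, ← inner_toCLM_conjTranspose_left, hs']
    exact h _
  have hneg : toCLM (-(star c * c)) v = -toCLM (star c * c) v := by
    rw [map_neg]
    rfl
  rw [hsT, hneg, CStarModule.inner_neg_right, hinner] at hnonneg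
  exact CStarModule.inner_self.mp
    (le_antisymm (neg_nonneg.mp hnonneg) CStarModule.inner_self_nonneg)

end CStarMatrix

namespace WithCStarModule

/-- Application of `f` to each coordinate of an element of the standard Hilbert C⋆-module. -/
def mapPi (f : B → A) (v : C⋆ᵐᵒᵈ(B, m → B)) : C⋆ᵐᵒᵈ(A, m → A) :=
  (WithCStarModule.equiv A (m → A)).symm fun i => f (v i)

theorem norm_mapPi_le (f : B →⋆ₙₐ[ℂ] A) (v : C⋆ᵐᵒᵈ(B, m → B)) : ‖mapPi f v‖ ≤ ‖v‖ := by
  have h : ∑ i, ⟪mapPi f v i, mapPi f v i⟫_A = f (∑ i, ⟪v i, v i⟫_B) := by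
    simp [WithCStarModule.inner_def, mapPi, map_star]
  rw [WithCStarModule.pi_norm, WithCStarModule.pi_norm, h]
  exact Real.sqrt_le_sqrt (NonUnitalStarAlgHom.norm_apply_le f _)

end WithCStarModule

namespace IsConditionalExpectation

variable {incl : B →⋆ₙₐ[ℂ] A} {E : A →ₗ[ℂ] B}

protected theorem map_nonneg (hE : IsConditionalExpectation incl E) {x : A} (hx : 0 ≤ x) :
    0 ≤ E x := by
  obtain ⟨z, rfl⟩ := CStarAlgebra.nonneg_iff_eq_star_mul_self.mp hx
  obtain ⟨y, hy⟩ := hE.positive z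
  rw [hy]
  exact star_mul_self_nonneg y

theorem exists_bound (hE : IsConditionalExpectation incl E) :
    ∃ C : ℝ≥0, ∀ x, ‖E x‖ ≤ C * ‖x‖ := by
  let f : A →ₚ[ℂ] B := { E with
    monotone' := fun a b hab => by
      have := hE.map_nonneg (sub_nonneg.mpr hab)
      rw [map_sub] at this
      exact sub_nonneg.mp this }
  exact PositiveLinearMap.exists_norm_apply_le f

/-- Positive maps preserve the adjoint, as positive elements span. -/
protected theorem map_star (hE : IsConditionalExpectation incl E) (x : A) :
    E (star x) = star (E x) := by
  obtain ⟨y, hy, -, hx⟩ := CStarAlgebra.exists_sum_four_nonneg x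
  have hsa : ∀ i, star (E (y i)) = E (y i) := fun i => (hE.map_nonneg (hy i)).isSelfAdjoint
  have hsa' : ∀ i, star (y i) = y i := fun i => (hy i).isSelfAdjoint
  rw [hx]
  simp only [star_sum, map_sum, star_smul, map_smul, hsa, hsa']

/-- The bimodule property in terms of the standard Hilbert C⋆-modules over `B` and `A`. -/
theorem inner_toCLM_map (hE : IsConditionalExpectation incl E) (X : CStarMatrix m m A)
    (v w : C⋆ᵐᵒᵈ(B, m → B)) :
    ⟪w, CStarMatrix.toCLM (X.map E) v⟫_B =
      E ⟪WithCStarModule.mapPi incl w, CStarMatrix.toCLM X (WithCStarModule.mapPi incl v)⟫_A := by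
  simp only [CStarMatrix.toCLM_apply_eq_sum, WithCStarModule.pi_inner,
    WithCStarModule.inner_def, WithCStarModule.mapPi, WithCStarModule.equiv_symm_pi_apply, map_sum,
    Finset.sum_mul, ← map_star, hE.bimodule, CStarMatrix.map_apply]

/-- The matrix amplifications of a conditional expectation are bounded uniformly in the size. -/
theorem exists_bound_map (hE : IsConditionalExpectation incl E) :
    ∃ C : ℝ≥0, ∀ (k : ℕ) (X : CStarMatrix (Fin k) (Fin k) A), ‖X.map E‖ ≤ C * ‖X‖ := by
  obtain ⟨C, hC⟩ := hE.exists_bound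
  refine ⟨C, fun k X => ?_⟩
  have := CStarMatrix.norm_le_of_forall_inner_le (M := X.map E) (C := C * ‖X‖₊) fun v w => by
    rw [hE.inner_toCLM_map]
    refine (hC _).trans ?_
    have h1 := CStarModule.norm_inner_le (A := A) (C⋆ᵐᵒᵈ(A, Fin k → A))
      (x := WithCStarModule.mapPi incl w) (y := CStarMatrix.toCLM X (WithCStarModule.mapPi incl v))
    have h2 := (CStarMatrix.toCLM X).le_opNorm (WithCStarModule.mapPi incl v)
    rw [← CStarMatrix.norm_def] at h2
    calc (C : ℝ) * ‖⟪WithCStarModule.mapPi incl w,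
            CStarMatrix.toCLM X (WithCStarModule.mapPi incl v)⟫_A‖
        ≤ C * (‖w‖ * (‖X‖ * ‖v‖)) := by
          gcongr
          refine h1.trans ?_
          gcongr
          · exact WithCStarModule.norm_mapPi_le incl w
          · exact h2.trans (by gcongr; exact WithCStarModule.norm_mapPi_le incl v)
      _ = _ := by push_cast; ring
  rwa [NNReal.coe_mul, coe_nnnorm] at this

/-- The matrix amplifications of a conditional expectation are positive. -/
theorem exists_map_star_mul_self (hE : IsConditionalExpectation incl E) (X : CStarMatrix m m A) :
    ∃ Y, (star X * X).map E = star Y * Y := by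
  refine CStarMatrix.exists_eq_star_mul_self_of_forall_inner ?_ fun v => ?_
  · refine CStarMatrix.ext fun p q => ?_
    have h : star ((star X * X) q p) = (star X * X) p q :=
      congrFun (congrFun (IsSelfAdjoint.star_mul_self X) p) q
    change star (E ((star X * X) q p)) = E ((star X * X) p q)
    rw [← hE.map_star, h]
  · rw [hE.inner_toCLM_map, CStarMatrix.toCLM_mul_apply,
      ← CStarMatrix.inner_toCLM_conjTranspose_left]
    exact hE.map_nonneg CStarModule.inner_self_nonneg

end IsConditionalExpectation
end MatrixAmplification

/-! ### Entrywise maps on `ℓ^∞(𝔾) ⊗̄ A` -/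

section Amplification

attribute [local instance] CStarAlgebra.spectralOrder CStarAlgebra.spectralOrderedRing

variable {ι : Type*} {n : ι → ℕ} {A B : Type*} [NonUnitalCStarAlgebra A] [NonUnitalCStarAlgebra B]

namespace BlockSum

/-- `id ⊗ f : ℓ^∞(𝔾) ⊗̄ B → ℓ^∞(𝔾) ⊗̄ A` for a `⋆`-homomorphism `f : B → A`, which acts on each
entry. -/
def mapHom (f : B →⋆ₙₐ[ℂ] A) : BlockSum n B →⋆ₙₐ[ℂ] BlockSum n A where
  toFun X := mk (fun i => CStarMatrix.mapₙₐ f (X.block i)) ‖X‖ fun i =>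
    (NonUnitalStarAlgHom.norm_apply_le (CStarMatrix.mapₙₐ f) (X.block i)).trans (X.norm_block_le i)
  map_smul' c X := ext fun i p q => map_smul f c (X.entry i p q)
  map_zero' := ext fun _ _ _ => map_zero f
  map_add' X Y := ext fun i p q => map_add f (X.entry i p q) (Y.entry i p q)
  map_mul' X Y := ext fun i p q => by
    change f ((X * Y).entry i p q) = ∑ r, f (X.entry i p r) * f (Y.entry i r q)
    simp only [entry_mul, map_sum, map_mul]
  map_star' X := ext fun i p q => map_star f (X.entry i q p)

theorem entry_mapHom (f : B →⋆ₙₐ[ℂ] A) (X : BlockSum n B) (i p q) :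
    (mapHom f X).entry i p q = f (X.entry i p q) := rfl

/-- `id ⊗ E : ℓ^∞(𝔾) ⊗̄ A → ℓ^∞(𝔾) ⊗̄ B` for a linear map `E : A → B` whose matrix amplifications
are bounded by a common constant `C`; no normality is needed, since `E` acts on each entry. -/
def mapLinear (E : A →ₗ[ℂ] B) (C : ℝ≥0)
    (hC : ∀ (k : ℕ) (X : CStarMatrix (Fin k) (Fin k) A), ‖X.map E‖ ≤ C * ‖X‖) :
    BlockSum n A →ₗ[ℂ] BlockSum n B where
  toFun X := mk (fun i => (X.block i).map E) (C * ‖X‖) fun i =>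
    (hC _ _).trans (mul_le_mul_of_nonneg_left (X.norm_block_le i) C.2)
  map_add' X Y := ext fun i p q => map_add E (X.entry i p q) (Y.entry i p q)
  map_smul' c X := ext fun i p q => map_smul E c (X.entry i p q)

/-- `(id ⊗ id ⊗ f)(Δ ⊗ id) = (Δ ⊗ id)(id ⊗ f)` for any linear map `f`, with `Y = (id ⊗ f)(X)`. -/
theorem comulTensorId_entry_map (D : BlockSum n ℂ →⋆ₙₐ[ℂ] BlockSum n (BlockSum n ℂ))
    (f : A →ₗ[ℂ] B) {X : BlockSum n A} {Y : BlockSum n B}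
    (h : ∀ i p q, Y.entry i p q = f (X.entry i p q)) (i p q j r s) :
    ((comulTensorId B D Y).entry i p q).entry j r s =
      f (((comulTensorId A D X).entry i p q).entry j r s) := by
  change comulBlock D Y i j p q r s = f (comulBlock D X i j p q r s)
  simp only [comulBlock_eq, map_sum, map_smul, h]

/-- Square roots of the blocks of a bounded family are again bounded. -/
theorem exists_eq_star_mul_self {X : BlockSum n A}
    (h : ∀ i, ∃ y : CStarMatrix (Fin (n i)) (Fin (n i)) A, X.block i = star y * y) :
    ∃ Y, X = star Y * Y := by
  choose y hy using h
  refine ⟨mk y √‖X‖ fun i => Real.le_sqrt_of_sq_le ?_, ext fun i p q => ?_⟩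
  · rw [sq, ← CStarRing.norm_star_mul_self, ← hy]
    exact X.norm_block_le i
  · exact congrFun (congrFun (hy i) p) q

end BlockSum

namespace IsConditionalExpectation

variable {incl : B →⋆ₙₐ[ℂ] A} {E : A →ₗ[ℂ] B}

/-- `id ⊗ E` is a conditional expectation onto `ℓ^∞(𝔾) ⊗̄ B`, also if `E` is not normal. -/
theorem exists_tensor (hE : IsConditionalExpectation incl E) (n : ι → ℕ) :
    ∃ T : BlockSum n A →ₗ[ℂ] BlockSum n B,
      IsConditionalExpectation (BlockSum.mapHom incl) T ∧
        ∀ X i p q, (T X).entry i p q = E (X.entry i p q) := by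
  obtain ⟨C, hC⟩ := hE.exists_bound_map
  refine ⟨BlockSum.mapLinear E C hC, ⟨fun X => ?_, fun Y => ?_, fun Y X Z => ?_⟩,
    fun _ _ _ _ => rfl⟩
  · exact BlockSum.exists_eq_star_mul_self fun i => hE.exists_map_star_mul_self (X.block i)
  · exact BlockSum.ext fun i p q => hE.map_incl (Y.entry i p q)
  · refine BlockSum.ext fun i p q => ?_
    change E ((BlockSum.mapHom incl Y * X * BlockSum.mapHom incl Z).entry i p q) =
      (Y * BlockSum.mapLinear E C hC X * Z).entry i p q
    simp only [BlockSum.entry_mul, BlockSum.entry_mapHom, Finset.sum_mul, map_sum, hE.bimodule]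
    rfl

variable {C : Type*} [NonUnitalCStarAlgebra C]

theorem comp {incl' : C →⋆ₙₐ[ℂ] B} {E' : B →ₗ[ℂ] C} (hE : IsConditionalExpectation incl E)
    (hE' : IsConditionalExpectation incl' E') :
    IsConditionalExpectation (incl.comp incl') (E' ∘ₗ E) where
  positive x := by
    obtain ⟨y, hy⟩ := hE.positive x
    obtain ⟨z, hz⟩ := hE'.positive y
    exact ⟨z, by rw [LinearMap.comp_apply, hy, hz]⟩
  map_incl c := by
    change E' (E (incl (incl' c))) = c
    rw [hE.map_incl, hE'.map_incl]
  bimodule b x c := by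
    change E' (E (incl (incl' b) * x * incl (incl' c))) = b * E' (E x) * c
    rw [hE.bimodule, hE'.bimodule]

/-- Restriction of a conditional expectation to an intermediate algebra `C`, embedded by `j`. -/
theorem restrict {i : B →⋆ₙₐ[ℂ] C} {j : C →⋆ₙₐ[ℂ] A} (hE : IsConditionalExpectation incl E)
    (h : ∀ b, j (i b) = incl b) :
    IsConditionalExpectation i (E ∘ₗ (j : C →ₗ[ℂ] A)) where
  positive x := by
    obtain ⟨y, hy⟩ := hE.positive (j x)
    exact ⟨y, by rw [← hy, ← map_star j, ← map_mul j]; rfl⟩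
  map_incl b := by
    change E (j (i b)) = b
    rw [h, hE.map_incl]
  bimodule b x c := by
    change E (j (i b * x * i c)) = b * E (j x) * c
    rw [map_mul j, map_mul j, h, h, hE.bimodule]

end IsConditionalExpectation
end Amplification

/-! ### Amenable actions -/

section Actions
universe u v

namespace DiscreteQuantumGroup

variable {G : DiscreteQuantumGroup.{v}} {A : Type u} [NonUnitalCStarAlgebra A]

/-- Amenability in terms of maps into `A` instead of maps into the range `α(A)`. -/
theorem Action.isAmenable_iff (α : G.Action A) :
    α.IsAmenable ↔ ∃ F : G.Tensor A →ₗ[ℂ] A, IsConditionalExpectation α.hom F ∧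
      ∀ X i p q, F ((G.comulId X).entry i p q) = (α.hom (F X)).entry i p q := by
  constructor
  · rintro ⟨E, hE, hΔ⟩
    let e := StarAlgEquiv.ofInjective' α.hom α.injective
    have he (y : NonUnitalStarAlgHom.range α.hom) : α.hom (e.symm y) = y :=
      congrArg Subtype.val (e.apply_symm_apply y)
    let F : G.Tensor A →ₗ[ℂ] A :=
      { toFun := fun X => e.symm (E X)
        map_add' := fun X Y => by rw [map_add, map_add]
        map_smul' := fun c X => by rw [map_smul, map_smul, RingHom.id_apply] }
    have hF (X) : α.hom (F X) = E X := he (E X)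
    refine ⟨F, ⟨fun X => ?_, fun a => ?_, fun a X b => ?_⟩, fun X i p q => α.injective ?_⟩
    · obtain ⟨y, hy⟩ := hE.positive X
      exact ⟨e.symm y, α.injective (by rw [hF, hy, map_mul, map_star, he]; rfl)⟩
    · exact α.injective ((hF _).trans (congrArg Subtype.val (hE.map_incl (e a))))
    · refine α.injective ((hF _).trans ?_)
      rw [map_mul α.hom, map_mul α.hom, hF]
      exact congrArg Subtype.val (hE.bimodule (e a) X (e b))
    · rw [hF, hΔ, ← hF, α.coaction]
  · rintro ⟨F, hF, hΔ⟩
    let r := NonUnitalStarAlgHom.rangeRestrict α.hom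
    have hr : ∀ y : NonUnitalStarAlgHom.range α.hom, ∃ a, r a = y := by
      rintro ⟨_, a, rfl⟩
      exact ⟨a, rfl⟩
    refine ⟨(r : A →ₗ[ℂ] NonUnitalStarAlgHom.range α.hom) ∘ₗ F,
      ⟨fun X => ?_, fun y => ?_, fun y X z => ?_⟩, fun X i p q => ?_⟩
    · obtain ⟨y, hy⟩ := hF.positive X
      refine ⟨r y, ?_⟩
      rw [← map_star, ← map_mul, ← hy]
      rfl
    · obtain ⟨a, rfl⟩ := hr y
      exact congrArg r (hF.map_incl a)
    · obtain ⟨a, rfl⟩ := hr y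
      obtain ⟨b, rfl⟩ := hr z
      refine (congrArg r (hF.bimodule a X b)).trans ?_
      rw [map_mul, map_mul]
      rfl
    · change α.hom (F ((G.comulId X).entry i p q)) = (G.comulId (α.hom (F X))).entry i p q
      rw [hΔ, α.coaction]

end DiscreteQuantumGroup
end Actions
end

theorem proposition4p5 {H : Type*} [NormedAddCommGroup H] [InnerProductSpace ℂ H]
    [CompleteSpace H] (G : DiscreteQuantumGroup) (M N : VonNeumannAlgebra H)
    (α : G.Action M) (β : G.Action N) (h : VonNeumannAlgebra.IsExtension β α) :
    (α.IsAmenable → VonNeumannAlgebra.IsAmenablePair h) ∧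
      (β.IsAmenable → VonNeumannAlgebra.IsAmenablePair h → α.IsAmenable) := by
  have hβ : ∀ x, BlockSum.mapHom (VonNeumannAlgebra.inclusion h.le) (α.hom x) =
      β.hom (VonNeumannAlgebra.inclusion h.le x) := fun x =>
    BlockSum.ext fun i p q => (h.restrict x i p q).symm
  constructor
  · intro hα
    obtain ⟨F, hF, hFΔ⟩ := α.isAmenable_iff.mp hα
    obtain ⟨Q, hQ⟩ := h.exists_expectation
    obtain ⟨T, hT, hTQ⟩ := hQ.exists_tensor G.dim
    refine ⟨(F ∘ₗ T) ∘ₗ (β.hom : N →ₗ[ℂ] G.Tensor N),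
      (hT.comp hF).restrict (fun x => (hβ x).symm), fun x i p q => ?_⟩
    change F (T (β.hom ((β.hom x).entry i p q))) = (α.hom (F (T (β.hom x)))).entry i p q
    rw [← hFΔ, ← β.coaction]
    refine congrArg F (BlockSum.ext fun j r s => ?_)
    rw [hTQ]
    exact (BlockSum.comulTensorId_entry_map G.comul Q (hTQ (β.hom x)) i p q j r s).symm
  · rintro hβa ⟨P, hP, hPeq⟩
    obtain ⟨F, hF, hFΔ⟩ := β.isAmenable_iff.mp hβa
    refine α.isAmenable_iff.mpr ⟨(P ∘ₗ F) ∘ₗ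
      (BlockSum.mapHom (n := G.dim) (VonNeumannAlgebra.inclusion h.le) :
        G.Tensor M →ₗ[ℂ] G.Tensor N),
      (hF.comp hP).restrict hβ, fun X i p q => ?_⟩
    set j := VonNeumannAlgebra.inclusion h.le
    change P (F (BlockSum.mapHom j ((G.comulId X).entry i p q))) =
      (α.hom (P (F (BlockSum.mapHom j X)))).entry i p q
    have hj : BlockSum.mapHom j ((G.comulId X).entry i p q) =
        (G.comulId (BlockSum.mapHom j X)).entry i p q := BlockSum.ext fun k r s =>
      (BlockSum.comulTensorId_entry_map G.comul (j : M →ₗ[ℂ] N)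
        (BlockSum.entry_mapHom j X) i p q k r s).symm
    rw [hj, hFΔ, hPeq]
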